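/- Setting. Let $f:\{0,1\}^d\to\{0,1\}$ be monotone and nonconstant, with $d\ge 2$. Write $\Delta(x,y)=\{i: x_i\ne y_i\}$. The sensitivity $S(f)$ is the maximum over $x$ of the number of features $i$ such that flipping $x_i$ changes $f(x)$. For an instance $x^\star$ let $\Delta_f(x^\star)=\min\{|\Delta(x^\star,x')| : f(x')\ne f(x^\star)\}$; an optimal counterfactual for $x^\star$ is an $x'$ with $f(x')\ne f(x^\star)$ and $|\Delta(x^\star,x')|=\Delta_f(x^\star)$. A restriction is a string $\rho\in\{0,1,*\}^d$; $\rho_{i\leftarrow b}$ is $\rho$ with $\rho_i$ overwritten with $b$, and $x^\star_\rho$ is $x^\star$ overwritten with the entries of $\rho$ that are not $*$. An implicit decision tree (IDT) for $f$ consists of two operations that access $f$ only through queries and navigate a decision tree $T$ computing $f$ exactly. Nodes of $T$ are given by the restriction $\rho$ of the features queried on the way to them, and by auxiliary information $A\subseteq[d]$, which is $\varnothing$ at the root and elsewhere is the set returned by the $\mathrm{Query}$ call at the parent. $\mathrm{IsLeaf}(\rho,A)$ tells whether $\rho$ is a leaf of $T$; for a non-leaf, $\mathrm{Query}(\rho,A)$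 returns the feature $i$ queried at $\rho$ (not yet fixed by $\rho$) and new auxiliary information $A'$. $\mathrm{FindMinimal}(\rho,x^\star,k,A)$ queries $f(x^\star)$ and $f(x^\star_\rho)$ and returns $\{x^\star_\rho\}$ if they differ; otherwise it returns $\varnothing$ if $\mathrm{IsLeaf}(\rho,A)$ holds or $k=0$; otherwise it lets $(i,A')=\mathrm{Query}(\rho,A)$ and returns $\mathrm{FindMinimal}(\rho_{i\leftarrow x^\star_i},x^\star,k,A')\cup\mathrm{FindMinimal}(\rho_{i\leftarrow 1-x^\star_i},x^\star,k-1,A')$. $\mathrm{FindOptimal}(x^\star)$ computes $\mathrm{FindMinimal}(*^d,x^\star,k,\varnothing)$ for $k=1,2,\dots,d$ until the result is nonempty, and returns it ($\varnothing$ if all the results are empty). The depth of the recursion is capped at $d$. Theorem. For every $a\in\mathbb N$ there is a constant $C$ such that for every $d\ge 2$ there are randomized operations $\mathrm{IsLeaf}$ and $\mathrm{Query}$, using finitely many random bits drawn once and depending on $f$ only through queries, such that for every nonconstant monotone $f:\{0,1\}^d\to\{0,1\}$: 1. with probability at least $1-d^{-a}$, the operations form an IDT for $f$ of depth at most $C\,S(f)^{C}$,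 each operation using at most $C\,S(f)^{C}\log d$ queries to $f$ at the nodes of the tree; 2. for every instance $x^\star\in\{0,1\}^d$, with probability at least $1-d^{-a}$, $\mathrm{FindOptimal}(x^\star)$, run with these operations, returns exactly the set of all optimal counterfactuals for $x^\star$ and makes at most $C\,S(f)^{C\,\Delta_f(x^\star)}\log d$ queries to $f$ in total. -/

import Mathlib

/-- Instances with `d` binary features (ordered coordinatewise, with `false < true`). -/
abbrev Cube (d : ℕ) : Type := Fin d → Bool

/-- The number of features of `x` that can be changed so that the value of `f` changes. -/
def sensitivityAt {d : ℕ} (f : Cube d → Bool) (x : Cube d) : ℕ :=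
  (Finset.univ.filter fun i : Fin d => ∃ a : Bool, f x ≠ f (Function.update x i a)).card

/-- The sensitivity `S(f)`: the maximum of the sensitivities of `f` at all instances. -/
def sensitivity {d : ℕ} (f : Cube d → Bool) : ℕ :=
  Finset.univ.sup (sensitivityAt f)

/-- The set of features on which two instances differ. -/
def diffSet {d : ℕ} (x y : Cube d) : Finset (Fin d) :=
  Finset.univ.filter fun i => x i ≠ y i

/-- The counterfactual complexity `Δ_f(x)`: the least number of features in which an instance with
another value of `f` differs from `x` (meaningful when such an instance exists). -/
noncomputable def cfComplexity {d : ℕ} (f : Cube d → Bool) (x : Cube d) : ℕ :=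
  sInf {n : ℕ | ∃ y : Cube d, f x ≠ f y ∧ (diffSet x y).card = n}

/-- The set of all optimal counterfactuals for `x`. -/
noncomputable def optimalCounterfactuals {d : ℕ} (f : Cube d → Bool) (x : Cube d) :
    Finset (Cube d) :=
  Finset.univ.filter fun y => f x ≠ f y ∧ (diffSet x y).card = cfComplexity f x

/-- Deterministic adaptive algorithms with output in `α` whose only access to the model
`f : Cube d → Bool` is by queries: either stop with an output, or query `f` at a point and go on
depending on the answer. -/
inductive QueryAlg (d : ℕ) (α : Type) : Type
  | ret (a : α) : QueryAlg d α
  | ask (x : Cube d) (next : Bool → QueryAlg d α) : QueryAlg d α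

namespace QueryAlg

variable {d : ℕ} {α β : Type}

/-- The output of the algorithm when the queries are answered by `f`. -/
def eval (f : Cube d → Bool) : QueryAlg d α → α
  | ret a => a
  | ask x next => eval f (next (f x))

/-- The number of queries that the algorithm makes when they are answered by `f`. -/
def cost (f : Cube d → Bool) : QueryAlg d α → ℕ
  | ret _ => 0
  | ask x next => cost f (next (f x)) + 1

/-- Sequential composition. -/
def bind : QueryAlg d α → (α → QueryAlg d β) → QueryAlg d β
  | ret a, g => g a
  | ask x next, g => ask x fun b => bind (next b) g

end QueryAlg

/-- Restrictions: partial functions from the features to `Bool`. -/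
abbrev Restriction (d : ℕ) : Type := Fin d → Option Bool

/-- The restriction `*^d` that fixes no feature. -/
def emptyRestriction (d : ℕ) : Restriction d := fun _ => none

/-- The restriction `ρ` with `ρ i` overwritten with `b`. -/
def Restriction.set {d : ℕ} (ρ : Restriction d) (i : Fin d) (b : Bool) : Restriction d :=
  Function.update ρ i (some b)

/-- The instance `x` overwritten by `ρ`. -/
def Restriction.overwrite {d : ℕ} (ρ : Restriction d) (x : Cube d) : Cube d :=
  fun i => (ρ i).getD (x i)

/-- Decision trees over `d` binary features. -/
inductive DTree (d : ℕ) : Type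
  | leaf (b : Bool) : DTree d
  | node (i : Fin d) (t₀ t₁ : DTree d) : DTree d

namespace DTree

variable {d : ℕ}

/-- The value that the tree computes on an instance. -/
def eval (x : Cube d) : DTree d → Bool
  | leaf b => b
  | node i t₀ t₁ => if x i then eval x t₁ else eval x t₀

/-- The depth: the largest number of features queried on a root-to-leaf path. -/
def depth : DTree d → ℕ
  | leaf _ => 0
  | node _ t₀ t₁ => max (depth t₀) (depth t₁) + 1

end DTree

/-- Implementations, by query algorithms, of the two operations `IsLeaf` and `Query` of an implicit
decision tree. Their inputs are a restriction (a node of the tree) and the auxiliary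
information, a set of features. -/
structure IDTOps (d : ℕ) : Type where
  isLeaf : Restriction d → Finset (Fin d) → QueryAlg d Bool
  query : Restriction d → Finset (Fin d) → QueryAlg d (Fin d × Finset (Fin d))

namespace IDTOps

variable {d : ℕ}

/-- The operations, run on `f`, correctly navigate the tree `t` placed at the node `ρ`, each with at
most `q` queries to `f`, when auxiliary information `A` is passed at `ρ` and, further down, every
call gets the auxiliary information returned by the `Query` call at the parent. -/
def Navigates (I : IDTOps d) (f : Cube d → Bool) (q : ℝ) :
    DTree d → Restriction d → Finset (Fin d) → Prop
  | .leaf _, ρ, A =>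
      (I.isLeaf ρ A).eval f = true ∧ ((I.isLeaf ρ A).cost f : ℝ) ≤ q
  | .node i t₀ t₁, ρ, A =>
      (I.isLeaf ρ A).eval f = false ∧ ((I.isLeaf ρ A).cost f : ℝ) ≤ q ∧
      ρ i = none ∧
      ((I.query ρ A).cost f : ℝ) ≤ q ∧
      ∃ A' : Finset (Fin d), (I.query ρ A).eval f = (i, A') ∧
        Navigates I f q t₀ (ρ.set i false) A' ∧ Navigates I f q t₁ (ρ.set i true) A'

/-- The operations, run on `f`, form an implicit decision tree of depth at most `h` that represents
`f` exactly, and each operation uses at most `q` queries to `f`. -/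
def IsIDT (I : IDTOps d) (f : Cube d → Bool) (q h : ℝ) : Prop :=
  ∃ t : DTree d, (∀ x, t.eval x = f x) ∧ (t.depth : ℝ) ≤ h ∧
    I.Navigates f q t (emptyRestriction d) ∅

/-- The recursive procedure `FindMinimal(ρ, x, k, A)` for the instance `x`, using the operations
`I`. The first number bounds the recursion depth; it is `d` at the root, which no path reaches
beyond, as a path of a decision tree queries no feature twice. -/
def findMinimal (I : IDTOps d) (x : Cube d) :
    ℕ → Restriction d → ℕ → Finset (Fin d) → QueryAlg d (Finset (Cube d))
  | n, ρ, k, A =>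
    QueryAlg.ask x fun b =>
    QueryAlg.ask (ρ.overwrite x) fun b' =>
    if b ≠ b' then QueryAlg.ret {ρ.overwrite x}
    else (I.isLeaf ρ A).bind fun l =>
      if l = true ∨ k = 0 then QueryAlg.ret ∅
      else (I.query ρ A).bind fun p =>
        match n with
        | 0 => QueryAlg.ret ∅
        | m + 1 =>
          (findMinimal I x m (ρ.set p.1 (x p.1)) k p.2).bind fun s =>
          (findMinimal I x m (ρ.set p.1 (!x p.1)) (k - 1) p.2).bind fun t =>
          QueryAlg.ret (s ∪ t)

/-- The loop of `FindOptimal`: call `FindMinimal` at the root with distance bounds `k, k + 1, …`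
until a call returns a nonempty set, with at most `n` calls in total. -/
def findOptimalLoop (I : IDTOps d) (x : Cube d) : ℕ → ℕ → QueryAlg d (Finset (Cube d))
  | 0, _ => QueryAlg.ret ∅
  | n + 1, k =>
    (findMinimal I x d (emptyRestriction d) k ∅).bind fun s =>
      if s = ∅ then findOptimalLoop I x n (k + 1) else QueryAlg.ret s

/-- The algorithm `FindOptimal(x)` using the operations `I`. Distance bounds beyond `d`
need not be tried, as two instances differ in at most `d` features. -/
def findOptimal (I : IDTOps d) (x : Cube d) : QueryAlg d (Finset (Cube d)) :=
  findOptimalLoop I x d 1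

end IDTOps

/-- The probability of an event over `m` independent fair coin flips. -/
noncomputable def coinProb {m : ℕ} (E : (Fin m → Bool) → Prop) : ℝ :=
  (Nat.card {r : Fin m → Bool // E r} : ℝ) / 2 ^ m

/-! No randomness is needed: the operations below use zero coins, so every event in question has
probability 1.

Write `S` for the sensitivity. The zeros of a maximal zero of `f` form a 0-certificate and are all
sensitive there, so every zero has a 0-certificate of size at most `S` (`exists_isZeroCertificate`).
Likewise a minterm of a restriction of `f` has at most `S` features, and binary search finds each of
them with about `log d` queries (`findMinterm_spec`). Every 0-certificate consistent with the
current node meets the minterm, since otherwise both values would be forced at once. Querying a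
whole minterm therefore removes a free feature from the certificate of every zero still possible
(`HasZeroCertificates.minterm`). After at most `S` rounds of at most `S` features the restriction is
constant, which gives depth at most `S ^ 2` (`exists_navigates`).

In a tree of depth `D`, `FindMinimal` follows only paths that deviate from the instance at most `k`
times, so it makes fewer than `2 (D + 1) ^ k` calls (`cost_findMinimal_le`). It finds every optimal
counterfactual once `k` reaches `Δ_f` (`mem_findMinimal_of_optimal`). As `Δ_f ≤ S`, the outer loop
costs only another factor `S`. -/

/-! ### Costs of composed query algorithms, and binary search -/

namespace QueryAlg

variable {d : ℕ} {α β : Type}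

@[simp] theorem eval_ret (f : Cube d → Bool) (a : α) : (ret a : QueryAlg d α).eval f = a := rfl

@[simp] theorem eval_ask (f : Cube d → Bool) (x : Cube d) (next : Bool → QueryAlg d α) :
    (ask x next).eval f = (next (f x)).eval f := rfl

@[simp] theorem cost_ret (f : Cube d → Bool) (a : α) : (ret a : QueryAlg d α).cost f = 0 := rfl

@[simp] theorem cost_ask (f : Cube d → Bool) (x : Cube d) (next : Bool → QueryAlg d α) :
    (ask x next).cost f = (next (f x)).cost f + 1 := rfl

@[simp] theorem eval_bind (f : Cube d → Bool) (p : QueryAlg d α) (g : α → QueryAlg d β) :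
    (p.bind g).eval f = (g (p.eval f)).eval f := by
  induction p with
  | ret a => rfl
  | ask x next ih => exact ih (f x)

@[simp] theorem cost_bind (f : Cube d → Bool) (p : QueryAlg d α) (g : α → QueryAlg d β) :
    (p.bind g).cost f = p.cost f + (g (p.eval f)).cost f := by
  induction p with
  | ret a => simp [bind]
  | ask x next ih =>
    have := ih (f x)
    simp only [bind, cost_ask, eval_ask]
    omega

/-- Binary search for a place in `[lo, lo + 2 ^ n)` at which the value of the model along the
sequence `g` of instances changes from `true` to `false`. -/
def binarySearch (g : ℕ → Cube d) : ℕ → ℕ → QueryAlg d ℕ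
  | 0, lo => ret lo
  | n + 1, lo => ask (g (lo + 2 ^ n)) fun b =>
      if b then binarySearch g n (lo + 2 ^ n) else binarySearch g n lo

theorem cost_binarySearch (f : Cube d → Bool) (g : ℕ → Cube d) (n lo : ℕ) :
    (binarySearch g n lo).cost f = n := by
  induction n generalizing lo with
  | zero => rfl
  | succ n ih =>
    simp only [binarySearch, cost_ask]
    split <;> simp [ih]

/-- The invariant is the value `true` at the left end and `false` at the right end; monotonicity
along `g` plays no role. -/
theorem binarySearch_spec (f : Cube d → Bool) (g : ℕ → Cube d) (n lo : ℕ)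
    (hlo : f (g lo) = true) (hhi : f (g (lo + 2 ^ n)) = false) :
    lo ≤ (binarySearch g n lo).eval f ∧ f (g ((binarySearch g n lo).eval f)) = true ∧
      f (g ((binarySearch g n lo).eval f + 1)) = false := by
  induction n generalizing lo with
  | zero => exact ⟨le_rfl, hlo, hhi⟩
  | succ n ih =>
    simp only [binarySearch, eval_ask]
    cases h : f (g (lo + 2 ^ n)) with
    | false => simpa using ih lo hlo h
    | true =>
      have := ih (lo + 2 ^ n) h (by rw [add_assoc, ← two_mul, ← pow_succ']; exact hhi)
      simp only [if_true]
      exact ⟨(Nat.le_add_right _ _).trans this.1, this.2⟩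

end QueryAlg

/-! ### Certificates of size at most the sensitivity -/

section Certificates

variable {d : ℕ} {f : Cube d → Bool}

theorem sensitivityAt_le_sensitivity (f : Cube d → Bool) (x : Cube d) :
    sensitivityAt f x ≤ sensitivity f :=
  Finset.le_sup (f := sensitivityAt f) (Finset.mem_univ x)

theorem card_le_sensitivity {x : Cube d} {M : Finset (Fin d)}
    (h : ∀ i ∈ M, ∃ b, f x ≠ f (Function.update x i b)) : M.card ≤ sensitivity f :=
  (Finset.card_le_card fun i hi => by simpa using h i hi).trans
    (sensitivityAt_le_sensitivity f x)

theorem sensitivity_le (f : Cube d → Bool) : sensitivity f ≤ d :=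
  Finset.sup_le fun _ _ => (Finset.card_le_univ _).trans (by simp)

theorem Monotone.eq_false_of_le (hf : Monotone f) {x y : Cube d} (h : x ≤ y)
    (hy : f y = false) : f x = false := by
  exact le_bot_iff.1 ((hf h).trans_eq hy)

theorem Monotone.eq_true_of_le (hf : Monotone f) {x y : Cube d} (h : x ≤ y)
    (hx : f x = true) : f y = true := by
  by_contra hy
  simp [hf.eq_false_of_le h (by simpa using hy)] at hx

/-- `W` is a set of features whose vanishing forces the monotone model `f` to vanish. -/
def IsZeroCertificate (f : Cube d → Bool) (W : Finset (Fin d)) : Prop :=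
  ∀ z : Cube d, (∀ i ∈ W, z i = false) → f z = false

/-- Take a maximal zero above `y`. Its zero features form a certificate by monotonicity, and by
maximality raising any one of them changes the value, so all are sensitive at the same instance. -/
theorem exists_isZeroCertificate (hf : Monotone f) {y : Cube d} (hy : f y = false) :
    ∃ W : Finset (Fin d), IsZeroCertificate f W ∧ (∀ i ∈ W, y i = false) ∧
      W.card ≤ sensitivity f := by
  obtain ⟨z, hyz, hz⟩ := Set.Finite.exists_le_maximal (Set.toFinite {z : Cube d | f z = false}) hy
  refine ⟨Finset.univ.filter fun i => z i = false, ?_, ?_, ?_⟩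
  · intro w hw
    refine hf.eq_false_of_le (y := z) (fun i => ?_) hz.prop
    cases h : z i with
    | true => exact Bool.le_true _
    | false => rw [hw i (by simpa using h)]
  · intro i hi
    have h1 := hyz i
    rw [(Finset.mem_filter.1 hi).2] at h1
    exact le_bot_iff.1 h1
  · refine card_le_sensitivity (x := z) fun i hi => ⟨true, fun h => ?_⟩
    have hzi := (Finset.mem_filter.1 hi).2
    have hle : z ≤ Function.update z i true := by
      intro j
      by_cases hj : j = i
      · subst hj; simp [Bool.le_true]
      · simp [hj]
    have := hz.le_of_ge (show f (Function.update z i true) = false from h ▸ hz.prop) hle i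
    simp only [hzi, Function.update_self] at this
    exact absurd (show true ≤ false from this) (by decide)

theorem exists_isOneCertificate (hf : Monotone f) {y : Cube d} (hy : f y = true) :
    ∃ W : Finset (Fin d), (∀ z : Cube d, (∀ i ∈ W, z i = true) → f z = true) ∧
      W.card ≤ sensitivity f := by
  obtain ⟨z, hyz, hz⟩ := Set.Finite.exists_le_minimal (Set.toFinite {z : Cube d | f z = true}) hy
  refine ⟨Finset.univ.filter fun i => z i = true, ?_, ?_⟩
  · intro w hw
    refine hf.eq_true_of_le (x := z) (fun i => ?_) hz.prop
    cases h : z i with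
    | false => exact Bool.false_le _
    | true => rw [hw i (by simpa using h)]
  · refine card_le_sensitivity (x := z) fun i hi => ⟨false, fun h => ?_⟩
    have hzi := (Finset.mem_filter.1 hi).2
    have hle : Function.update z i false ≤ z := by
      intro j
      by_cases hj : j = i
      · subst hj; simp [Bool.false_le]
      · simp [hj]
    have := hz.le_of_le (show f (Function.update z i false) = true from h ▸ hz.prop) hle i
    simp only [hzi, Function.update_self] at this
    exact absurd (show true ≤ false from this) (by decide)

end Certificates

/-! ### Counterfactual complexity is at most the sensitivity -/

section Counterfactuals

variable {d : ℕ} {f : Cube d → Bool}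

theorem mem_diffSet {x y : Cube d} {i : Fin d} : i ∈ diffSet x y ↔ x i ≠ y i := by
  simp [diffSet]

theorem cfComplexity_le {x y : Cube d} (h : f x ≠ f y) :
    cfComplexity f x ≤ (diffSet x y).card :=
  Nat.sInf_le ⟨y, h, rfl⟩

theorem exists_counterfactual (hne : ∃ y z, f y ≠ f z) (x : Cube d) : ∃ y, f x ≠ f y := by
  obtain ⟨y, z, h⟩ := hne
  by_cases hy : f x = f y
  · exact ⟨z, hy ▸ h⟩
  · exact ⟨y, hy⟩

theorem exists_optimal (hne : ∃ y z, f y ≠ f z) (x : Cube d) :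
    ∃ y, f x ≠ f y ∧ (diffSet x y).card = cfComplexity f x := by
  obtain ⟨y, hy⟩ := exists_counterfactual hne x
  exact Nat.sInf_mem
    (s := {n : ℕ | ∃ y : Cube d, f x ≠ f y ∧ (diffSet x y).card = n}) ⟨_, y, hy, rfl⟩

theorem cfComplexity_pos (hne : ∃ y z, f y ≠ f z) (x : Cube d) : 1 ≤ cfComplexity f x := by
  obtain ⟨y, hy, hc⟩ := exists_optimal hne x
  rw [← hc, Nat.one_le_iff_ne_zero, Finset.card_ne_zero]
  by_contra h
  refine hy (congrArg f (funext fun i => ?_))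
  by_contra hi
  exact h ⟨i, by simpa [diffSet] using hi⟩

/-- Overwriting `x` on a certificate for the opposite value yields a counterfactual. This bounds the
number of rounds of `FindOptimal`. -/
theorem cfComplexity_le_sensitivity (hf : Monotone f) (hne : ∃ y z, f y ≠ f z) (x : Cube d) :
    cfComplexity f x ≤ sensitivity f := by
  obtain ⟨y, hy⟩ := exists_counterfactual hne x
  have key : ∀ (W : Finset (Fin d)) (b : Bool), f x ≠ b →
      (∀ z : Cube d, (∀ i ∈ W, z i = b) → f z = b) → cfComplexity f x ≤ W.card := by
    intro W b hb hW
    have hz : f (fun i => if i ∈ W then b else x i) = b := hW _ fun i hi => by simp [hi]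
    refine (cfComplexity_le (hz ▸ hb)).trans (Finset.card_le_card fun i hi => ?_)
    by_contra h
    simp [diffSet, h] at hi
  cases hfy : f y with
  | false =>
    obtain ⟨W, h1, -, h2⟩ := exists_isZeroCertificate hf hfy
    exact (key W false (hfy ▸ hy) h1).trans h2
  | true =>
    obtain ⟨W, h1, h2⟩ := exists_isOneCertificate hf hfy
    exact (key W true (hfy ▸ hy) h1).trans h2

end Counterfactuals

/-! ### Finding a minterm by binary search -/

section Minterm

variable {d : ℕ} {f : Cube d → Bool}

/-- The instance that agrees with `ρ` on the features fixed by `ρ`, and has there the value `true`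
exactly at the other features that lie in `M` or are numbered at least `j`. -/
def fillFrom (ρ : Restriction d) (M : Finset (Fin d)) (j : ℕ) : Cube d :=
  fun i => (ρ i).getD (decide (i ∈ M ∨ j ≤ i.val))

theorem fillFrom_antitone (ρ : Restriction d) (M : Finset (Fin d)) :
    Antitone (fillFrom ρ M) := by
  intro j k hjk i
  unfold fillFrom
  cases ρ i with
  | some b => exact le_rfl
  | none =>
    simp only [Option.getD_none]
    intro h
    simp only [decide_eq_true_eq] at h ⊢
    exact h.imp_right fun h => hjk.trans h

theorem fillFrom_eq_of_le (ρ : Restriction d) (M : Finset (Fin d)) {j : ℕ} (hj : d ≤ j) :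
    fillFrom ρ M j = fillFrom ρ M d := by
  funext i
  have h1 : ¬ j ≤ i.val := by omega
  have h2 : ¬ d ≤ i.val := by omega
  simp only [fillFrom, h1, h2]

/-- Putting `j` into `M` makes up for moving the threshold past `j`, so the search resumes at an
instance already known to be a one. -/
theorem fillFrom_insert (ρ : Restriction d) (M : Finset (Fin d)) (j : Fin d) :
    fillFrom ρ (insert j M) (j.val + 1) = fillFrom ρ M j.val := by
  funext i
  have : (i = j ∨ i ∈ M) ∨ j.val + 1 ≤ i.val ↔ i ∈ M ∨ j.val ≤ i.val := by
    rw [Fin.ext_iff]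
    constructor
    · rintro ((h | h) | h)
      · exact Or.inr h.ge
      · exact Or.inl h
      · exact Or.inr (by omega)
    · rintro (h | h)
      · exact Or.inl (Or.inr h)
      · rcases h.eq_or_lt with h | h
        · exact Or.inl (Or.inl h.symm)
        · exact Or.inr h
  simp only [fillFrom, Finset.mem_insert, this]

/-- The features in `M` are free in `ρ` and numbered below `lo`, the model is `true` at
`fillFrom ρ M lo`, and it is critical there that the features in `M` are `true`. -/
structure IsPartialMinterm (f : Cube d → Bool) (ρ : Restriction d) (M : Finset (Fin d))
    (lo : ℕ) : Prop where
  free : ∀ i ∈ M, ρ i = none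
  val : f (fillFrom ρ M lo) = true
  critical : ∀ i ∈ M, f (Function.update (fillFrom ρ M lo) i false) = false

theorem IsPartialMinterm.card_le {ρ : Restriction d} {M : Finset (Fin d)} {lo : ℕ}
    (h : IsPartialMinterm f ρ M lo) : M.card ≤ sensitivity f :=
  card_le_sensitivity fun i hi => ⟨false, by rw [h.val, h.critical i hi]; decide⟩

/-- The value drops exactly when `j` is lowered, so `j` is free, new and critical. The older
features stay critical because the instance has only decreased. -/
theorem IsPartialMinterm.insert (hf : Monotone f) {ρ : Restriction d} {M : Finset (Fin d)} {lo : ℕ}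
    (h : IsPartialMinterm f ρ M lo) {j : Fin d} (hlo : lo ≤ j.val)
    (h1 : f (fillFrom ρ M j) = true) (h2 : f (fillFrom ρ M (j.val + 1)) = false) :
    j ∉ M ∧ IsPartialMinterm f ρ (insert j M) (j.val + 1) := by
  have hne : fillFrom ρ M j ≠ fillFrom ρ M (j.val + 1) := fun h => by simp [h, h2] at h1
  have hM : j ∉ M := fun hj => hne (by rw [← fillFrom_insert, Finset.insert_eq_of_mem hj])
  have hupd : Function.update (fillFrom ρ M j) j false ≤ fillFrom ρ M (j.val + 1) := by
    intro i
    by_cases hi : i = j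
    · subst hi; simp [Bool.false_le]
    · have hi' : i.val ≠ j.val := fun h => hi (Fin.ext h)
      have : j.val + 1 ≤ i.val ↔ j.val ≤ i.val := by omega
      simp [hi, fillFrom, this]
  refine ⟨hM, ⟨?_, ?_, ?_⟩⟩
  · intro i hi
    rcases Finset.mem_insert.1 hi with rfl | hi
    · by_contra hρ
      obtain ⟨b, hb⟩ := Option.ne_none_iff_exists'.1 hρ
      refine hne (funext fun k => ?_)
      by_cases hk : k = i
      · subst hk; simp [fillFrom, hb]
      · have hk' : k.val ≠ i.val := fun h => hk (Fin.ext h)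
        have : i.val + 1 ≤ k.val ↔ i.val ≤ k.val := by omega
        simp [fillFrom, this]
    · exact h.free i hi
  · rw [fillFrom_insert]; exact h1
  · intro i hi
    rw [fillFrom_insert]
    rcases Finset.mem_insert.1 hi with rfl | hi
    · exact hf.eq_false_of_le hupd h2
    · refine hf.eq_false_of_le ?_ (h.critical i hi)
      exact update_le_update_iff.2
        ⟨le_rfl, fun k _ => fillFrom_antitone ρ M hlo k⟩

/-- Extends a partial minterm to a minterm of the model restricted by `ρ`, finding each of its
features by binary search. The first number bounds the number of features added. -/
def findMinterm (ρ : Restriction d) : ℕ → Finset (Fin d) → ℕ → QueryAlg d (Finset (Fin d))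
  | 0, M, _ => .ret M
  | n + 1, M, lo => .ask (fillFrom ρ M d) fun b =>
      if b then .ret M
      else (QueryAlg.binarySearch (fillFrom ρ M) (Nat.clog 2 d) lo).bind fun j =>
        if h : j < d then findMinterm ρ n (insert ⟨j, h⟩ M) (j + 1) else .ret M

/-- All features of a partial minterm are sensitive at one instance, so at most `S` can ever be
collected. The hypothesis on `n` thus prevents the bound on added features from cutting the search
short. -/
theorem findMinterm_spec (hf : Monotone f) (ρ : Restriction d) (n : ℕ) (M : Finset (Fin d))
    (lo : ℕ) (h : IsPartialMinterm f ρ M lo) (hn : sensitivity f + 1 ≤ n + M.card) :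
    IsPartialMinterm f ρ ((findMinterm ρ n M lo).eval f) d ∧
      (findMinterm ρ n M lo).cost f ≤ (sensitivity f + 1 - M.card) * (Nat.clog 2 d + 1) := by
  induction n generalizing M lo with
  | zero => have := h.card_le; omega
  | succ n ih =>
    have hcard := h.card_le
    cases hb : f (fillFrom ρ M d) with
    | true =>
      have hle : fillFrom ρ M d ≤ fillFrom ρ M lo := by
        rcases le_total lo d with hd | hd
        · exact fillFrom_antitone ρ M hd
        · exact (fillFrom_eq_of_le ρ M hd).ge
      simp only [findMinterm, QueryAlg.eval_ask, QueryAlg.cost_ask, hb, if_true,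
        QueryAlg.eval_ret, QueryAlg.cost_ret]
      refine ⟨⟨h.free, hb, fun i hi => hf.eq_false_of_le ?_ (h.critical i hi)⟩, ?_⟩
      · exact update_le_update_iff.2 ⟨le_rfl, fun k _ => hle k⟩
      -- The first factor is positive as `M.card ≤ S`; the product pays for the one query made here.
      · exact Nat.mul_pos (by omega) (by omega)
    | false =>
      have hhi : f (fillFrom ρ M (lo + 2 ^ Nat.clog 2 d)) = false := by
        rw [fillFrom_eq_of_le ρ M, hb]
        have := Nat.le_pow_clog (b := 2) (by norm_num) d
        omega
      obtain ⟨h1, h2, h3⟩ :=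
        QueryAlg.binarySearch_spec f (fillFrom ρ M) (Nat.clog 2 d) lo h.val hhi
      have hc := QueryAlg.cost_binarySearch f (fillFrom ρ M) (Nat.clog 2 d) lo
      simp only [findMinterm, QueryAlg.eval_ask, QueryAlg.cost_ask, hb, QueryAlg.eval_bind,
        QueryAlg.cost_bind, hc, Bool.false_eq_true, if_false]
      generalize (QueryAlg.binarySearch (fillFrom ρ M) (Nat.clog 2 d) lo).eval f = j at h1 h2 h3
      -- From threshold `d` on the instance is constant with value `false`, so the drop lies earlier
      -- and the default branch is not taken.
      have hj : j < d := by
        by_contra hj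
        rw [fillFrom_eq_of_le ρ M (by omega), hb] at h2
        simp at h2
      obtain ⟨hjM, h'⟩ := h.insert hf (j := ⟨j, hj⟩) h1 h2 h3
      have hcard' := h'.card_le
      rw [Finset.card_insert_of_notMem hjM] at hcard'
      obtain ⟨i1, i2⟩ := ih _ _ h' (by rw [Finset.card_insert_of_notMem hjM]; omega)
      rw [Finset.card_insert_of_notMem hjM] at i2
      dsimp only at i1 i2
      simp only [hj, dif_pos]
      refine ⟨i1, ?_⟩
      obtain ⟨e, he⟩ : ∃ e, sensitivity f + 1 - M.card = e + 1 := ⟨sensitivity f - M.card, by omega⟩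
      have he' : sensitivity f + 1 - (M.card + 1) = e := by omega
      rw [he'] at i2
      rw [he, Nat.succ_mul]
      omega

end Minterm

/-! ### The minterm tree and its depth -/

section Navigation

variable {d : ℕ} {f : Cube d → Bool}

/-- The instance agrees with the restriction. -/
def Restriction.Agrees (ρ : Restriction d) (x : Cube d) : Prop :=
  ∀ i b, ρ i = some b → x i = b

theorem Restriction.Agrees.of_set {ρ : Restriction d} {i : Fin d} {b : Bool} {x : Cube d}
    (h : (ρ.set i b).Agrees x) (hi : ρ i = none) : ρ.Agrees x ∧ x i = b := by
  refine ⟨fun j c hj => h j c ?_, h i b (by simp [Restriction.set])⟩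
  have : j ≠ i := by rintro rfl; simp [hi] at hj
  simpa [Restriction.set, this] using hj

theorem Restriction.Agrees.set {ρ : Restriction d} {i : Fin d} {x : Cube d}
    (h : ρ.Agrees x) : (ρ.set i (x i)).Agrees x := by
  intro j c hj
  by_cases hji : j = i
  · subst hji; simpa [Restriction.set] using hj
  · exact h j c (by simpa [Restriction.set, hji] using hj)

theorem Restriction.agrees_overwrite (ρ : Restriction d) (x : Cube d) :
    ρ.Agrees (ρ.overwrite x) := by
  intro i b h
  simp [Restriction.overwrite, h]

/-- The features that are not fixed. -/
def Restriction.free (ρ : Restriction d) : Finset (Fin d) :=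
  Finset.univ.filter fun i => ρ i = none

theorem Restriction.mem_free {ρ : Restriction d} {i : Fin d} : i ∈ ρ.free ↔ ρ i = none := by
  simp [Restriction.free]

theorem Restriction.free_set (ρ : Restriction d) (i : Fin d) (b : Bool) :
    (ρ.set i b).free = ρ.free.erase i := by
  ext j
  by_cases hj : j = i
  · subst hj; simp [Restriction.mem_free, Restriction.set]
  · simp [Restriction.mem_free, Restriction.set, hj]

/-- A feature of `A` that is not fixed by `ρ` if there is one, and otherwise `i₀`. -/
noncomputable def freeFeature (i₀ : Fin d) (ρ : Restriction d) (A : Finset (Fin d)) : Fin d :=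
  if h : (A ∩ ρ.free).Nonempty then h.choose else i₀

theorem freeFeature_mem (i₀ : Fin d) {ρ : Restriction d} {A : Finset (Fin d)}
    (h : (A ∩ ρ.free).Nonempty) : freeFeature i₀ ρ A ∈ A ∩ ρ.free := by
  rw [freeFeature, dif_pos h]
  exact h.choose_spec

/-- The implicit decision tree that queries, one after the other, all features of a minterm of the
current restriction of the model, which is kept as auxiliary information, until the model
is constant. -/
noncomputable def mintermOps (i₀ : Fin d) : IDTOps d where
  isLeaf ρ _ := .ask (ρ.overwrite fun _ => false) fun b =>
    .ask (ρ.overwrite fun _ => true) fun b' => .ret (b == b')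
  query ρ A :=
    if (A ∩ ρ.free).Nonempty then .ret (freeFeature i₀ ρ A, A)
    else (findMinterm ρ (d + 1) ∅ 0).bind fun M => .ret (freeFeature i₀ ρ M, M)

/-- A bound for the number of queries by an operation of `mintermOps`. -/
def mintermCost (f : Cube d → Bool) : ℕ := (sensitivity f + 1) * (Nat.clog 2 d + 1)

theorem Restriction.Agrees.overwrite_le {ρ : Restriction d} {x : Cube d} (h : ρ.Agrees x) :
    (ρ.overwrite fun _ => false) ≤ x := by
  intro i
  cases hρ : ρ i with
  | none => simp [Restriction.overwrite, hρ, Bool.false_le]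
  | some b => simp [Restriction.overwrite, hρ, h i b hρ]

theorem Restriction.Agrees.le_overwrite {ρ : Restriction d} {x : Cube d} (h : ρ.Agrees x) :
    x ≤ ρ.overwrite fun _ => true := by
  intro i
  cases hρ : ρ i with
  | none => simp [Restriction.overwrite, hρ, Bool.le_true]
  | some b => simp [Restriction.overwrite, hρ, h i b hρ]

/-- Every zero of the model that agrees with `ρ` has a certificate with at most `r` features that
are free in `ρ` and lie outside `A`. -/
def HasZeroCertificates (f : Cube d → Bool) (ρ : Restriction d) (A : Finset (Fin d)) (r : ℕ) :
    Prop :=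
  ∀ y : Cube d, ρ.Agrees y → f y = false → ∃ W : Finset (Fin d), IsZeroCertificate f W ∧
    (∀ i ∈ W, y i = false) ∧ ((W ∩ ρ.free) \ A).card ≤ r

theorem HasZeroCertificates.set {ρ : Restriction d} {A : Finset (Fin d)} {r : ℕ}
    (h : HasZeroCertificates f ρ A r) {i : Fin d} (hi : ρ i = none) (b : Bool) :
    HasZeroCertificates f (ρ.set i b) A r := by
  intro y hy hfy
  obtain ⟨W, h1, h2, h3⟩ := h y (hy.of_set hi).1 hfy
  refine ⟨W, h1, h2, (Finset.card_le_card ?_).trans h3⟩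
  rw [Restriction.free_set]
  gcongr
  exact Finset.erase_subset _ _

/-- The progress of one round: a certificate disjoint from the free features of `M` would force the
value `false` at `fillFrom ρ M d`. Only the value there is used; criticality of `M` matters for its
size alone. -/
theorem HasZeroCertificates.minterm {ρ : Restriction d} {A M : Finset (Fin d)} {r : ℕ}
    (h : HasZeroCertificates f ρ A (r + 1)) (hA : ¬ (A ∩ ρ.free).Nonempty)
    (hM : f (fillFrom ρ M d) = true) : HasZeroCertificates f ρ M r := by
  intro y hy hfy
  obtain ⟨W, h1, h2, h3⟩ := h y hy hfy
  refine ⟨W, h1, h2, ?_⟩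
  obtain ⟨i, hiW, hi⟩ : ∃ i ∈ W, fillFrom ρ M d i = true := by
    by_contra hcon
    push Not at hcon
    have := h1 (fillFrom ρ M d) fun i hi => by simpa using hcon i hi
    simp [this] at hM
  have hfree : ρ i = none := by
    cases hρ : ρ i with
    | none => rfl
    | some b => simp [fillFrom, hρ, ← hy i b hρ, h2 i hiW] at hi
  have hiM : i ∈ M := by
    have : ¬ d ≤ i.val := by omega
    simpa [fillFrom, hfree, this] using hi
  have hlt : ((W ∩ ρ.free) \ M).card < ((W ∩ ρ.free) \ A).card := by
    refine Finset.card_lt_card (Finset.ssubset_iff_of_subset ?_ |>.2 ⟨i, ?_, ?_⟩)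
    · intro j hj
      simp only [Finset.mem_sdiff, Finset.mem_inter] at hj ⊢
      exact ⟨hj.1, fun hjA => hA ⟨j, Finset.mem_inter.2 ⟨hjA, hj.1.2⟩⟩⟩
    · simp only [Finset.mem_sdiff, Finset.mem_inter, Restriction.mem_free]
      exact ⟨⟨hiW, hfree⟩, fun hiA =>
        hA ⟨i, Finset.mem_inter.2 ⟨hiA, Restriction.mem_free.2 hfree⟩⟩⟩
    · simp [hiM]
  omega

/-- The potential `r * S + (A ∩ ρ.free).card` bounds the remaining depth. Each query removes a free
feature of `A`; a new minterm adds at most `S` of them and lowers `r` by one. -/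
theorem exists_navigates (hf : Monotone f) (i₀ : Fin d) (hS : 1 ≤ sensitivity f) (n : ℕ)
    (ρ : Restriction d) (A : Finset (Fin d)) (r : ℕ) (h : HasZeroCertificates f ρ A r)
    (hn : r * sensitivity f + (A ∩ ρ.free).card ≤ n) :
    ∃ t : DTree d, (∀ x, ρ.Agrees x → t.eval x = f x) ∧ t.depth ≤ n ∧
      (mintermOps i₀).Navigates f (mintermCost f) t ρ A := by
  have hlog : 2 ≤ mintermCost f := by
    have : 2 * 1 ≤ (sensitivity f + 1) * (Nat.clog 2 d + 1) :=
      Nat.mul_le_mul (by omega) (by omega)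
    exact this
  have hleafcost : (((mintermOps i₀).isLeaf ρ A).cost f : ℝ) ≤ mintermCost f := by
    exact_mod_cast hlog
  -- By monotonicity, equal values at the two extreme instances mean that the restriction is
  -- constant.
  by_cases hconst : f (ρ.overwrite fun _ => false) = f (ρ.overwrite fun _ => true)
  · refine ⟨.leaf (f (ρ.overwrite fun _ => false)), fun x hx => ?_, Nat.zero_le _, ?_, hleafcost⟩
    · refine le_antisymm (hf hx.overwrite_le) ?_
      rw [DTree.eval, hconst]
      exact hf hx.le_overwrite
    · simpa [mintermOps] using hconst
  have h0 : f (ρ.overwrite fun _ => false) = false := by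
    by_contra h0
    have h0 : f (ρ.overwrite fun _ => false) = true := by simpa using h0
    refine hconst (h0.trans (hf.eq_true_of_le ?_ h0).symm)
    exact (ρ.agrees_overwrite _).le_overwrite
  have h1 : f (ρ.overwrite fun _ => true) = true := by
    cases hh : f (ρ.overwrite fun _ => true) with
    | true => rfl
    | false => exact absurd (h0.trans hh.symm) hconst
  have hleaf : ((mintermOps i₀).isLeaf ρ A).eval f = false := by
    simp [mintermOps, h0, h1]
  have step : ∃ (A' : Finset (Fin d)) (r' : ℕ),
      ((mintermOps i₀).query ρ A).eval f = (freeFeature i₀ ρ A', A') ∧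
      ((mintermOps i₀).query ρ A).cost f ≤ mintermCost f ∧
      (A' ∩ ρ.free).Nonempty ∧ HasZeroCertificates f ρ A' r' ∧
      r' * sensitivity f + (A' ∩ ρ.free).card ≤ n := by
    by_cases hA : (A ∩ ρ.free).Nonempty
    · exact ⟨A, r, by simp [mintermOps, hA], by simp [mintermOps, hA], hA, h, hn⟩
    have hstart : IsPartialMinterm f ρ ∅ 0 := by
      refine ⟨by simp, ?_, by simp⟩
      convert h1 using 2
      funext i
      simp [fillFrom, Restriction.overwrite]
    obtain ⟨hM, hcost⟩ := findMinterm_spec hf ρ (d + 1) ∅ 0 hstart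
      (by have := sensitivity_le f; simp; omega)
    set M := (findMinterm ρ (d + 1) ∅ 0).eval f with hMdef
    have hsub : M ∩ ρ.free = M :=
      Finset.inter_eq_left.2 fun i hi => Restriction.mem_free.2 (hM.free i hi)
    have hne : M.Nonempty := by
      by_contra hne
      rw [Finset.not_nonempty_iff_eq_empty] at hne
      have hv := hM.val
      rw [hne] at hv
      have : fillFrom ρ ∅ d = ρ.overwrite fun _ => false := by
        funext i
        have : ¬ d ≤ i.val := by omega
        simp [fillFrom, Restriction.overwrite, this]
      rw [this, h0] at hv
      simp at hv
    -- If `r = 0`, the certificate of the least instance has only fixed features, on which the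
    -- greatest instance agrees with it; then `f` would vanish at the greatest one too.
    obtain ⟨r', rfl⟩ : ∃ r', r = r' + 1 := by
      refine Nat.exists_eq_succ_of_ne_zero ?_
      rintro rfl
      obtain ⟨W, w1, w2, w3⟩ := h _ (ρ.agrees_overwrite fun _ => false) h0
      have hW : ∀ i ∈ W, (ρ.overwrite fun _ => true) i = false := by
        intro i hi
        have hfree : ρ i ≠ none := by
          intro hfree
          have hmem : i ∈ (W ∩ ρ.free) \ A :=
            Finset.mem_sdiff.2 ⟨Finset.mem_inter.2 ⟨hi, Restriction.mem_free.2 hfree⟩,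
              fun hiA => hA ⟨i, Finset.mem_inter.2 ⟨hiA, Restriction.mem_free.2 hfree⟩⟩⟩
          have := Finset.card_pos.2 ⟨i, hmem⟩
          omega
        obtain ⟨b, hb⟩ := Option.ne_none_iff_exists'.1 hfree
        simpa [Restriction.overwrite, hb] using w2 i hi
      have := w1 _ hW
      simp [this] at h1
    refine ⟨M, r', by simp [mintermOps, hA, hMdef], ?_, hsub.symm ▸ hne, h.minterm hA hM.val, ?_⟩
    · simpa [mintermOps, hA, mintermCost] using hcost
    · rw [hsub]
      have := hM.card_le
      rw [Nat.succ_mul] at hn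
      omega
  obtain ⟨A', r', hq, hqc, hA', hcert, hle⟩ := step
  have hmem := freeFeature_mem i₀ hA'
  set i := freeFeature i₀ ρ A'
  have hi : ρ i = none := Restriction.mem_free.1 (Finset.mem_inter.1 hmem).2
  have hpos := Finset.card_pos.2 hA'
  obtain ⟨n, rfl⟩ : ∃ n', n = n' + 1 := Nat.exists_eq_succ_of_ne_zero (by omega)
  have child : ∀ b, r' * sensitivity f + (A' ∩ (ρ.set i b).free).card ≤ n := by
    intro b
    rw [Restriction.free_set, Finset.inter_erase, Finset.card_erase_of_mem hmem]
    omega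
  obtain ⟨t₀, e₀, d₀, n₀⟩ :=
    exists_navigates hf i₀ hS n (ρ.set i false) A' r' (hcert.set hi false) (child false)
  obtain ⟨t₁, e₁, d₁, n₁⟩ :=
    exists_navigates hf i₀ hS n (ρ.set i true) A' r' (hcert.set hi true) (child true)
  refine ⟨.node i t₀ t₁, fun x hx => ?_, ?_, hleaf, hleafcost, hi, by exact_mod_cast hqc,
    A', hq, n₀, n₁⟩
  · have hxs := hx.set (i := i)
    cases hxi : x i with
    | false => simpa [DTree.eval, hxi] using e₀ x (hxi ▸ hxs)
    | true => simpa [DTree.eval, hxi] using e₁ x (hxi ▸ hxs)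
  · simp only [DTree.depth]
    omega
termination_by n

theorem exists_navigates_root (hf : Monotone f) (i₀ : Fin d) (hS : 1 ≤ sensitivity f) :
    ∃ t : DTree d, (∀ x, t.eval x = f x) ∧ t.depth ≤ sensitivity f * sensitivity f ∧
      (mintermOps i₀).Navigates f (mintermCost f) t (emptyRestriction d) ∅ := by
  obtain ⟨t, h1, h2, h3⟩ := exists_navigates hf i₀ hS (sensitivity f * sensitivity f)
    (emptyRestriction d) ∅ (sensitivity f) (fun y _ hfy => by
      obtain ⟨W, w1, w2, w3⟩ := exists_isZeroCertificate hf hfy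
      refine ⟨W, w1, w2, (Finset.card_le_card ?_).trans w3⟩
      exact Finset.sdiff_subset.trans Finset.inter_subset_left) (by simp)
  exact ⟨t, fun x => h1 x (by intro i b h; simp [emptyRestriction] at h), h2, h3⟩

end Navigation

/-! ### Correctness and cost of the search for counterfactuals -/

section FindMinimal

variable {d : ℕ} {f : Cube d → Bool}

theorem Restriction.diffSet_overwrite_set_self {ρ : Restriction d} {i : Fin d} (x : Cube d) :
    diffSet x ((ρ.set i (x i)).overwrite x) = (diffSet x (ρ.overwrite x)).erase i := by
  ext j
  by_cases hj : j = i
  · subst hj; simp [mem_diffSet, Restriction.overwrite, Restriction.set]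
  · simp [mem_diffSet, Restriction.overwrite, Restriction.set, hj]

theorem Restriction.diffSet_overwrite_set_not {ρ : Restriction d} {i : Fin d} (x : Cube d) :
    diffSet x ((ρ.set i (!x i)).overwrite x) = insert i (diffSet x (ρ.overwrite x)) := by
  ext j
  by_cases hj : j = i
  · subst hj; simp [mem_diffSet, Restriction.overwrite, Restriction.set]
  · simp [mem_diffSet, Restriction.overwrite, Restriction.set, hj]

theorem Restriction.notMem_diffSet_overwrite {ρ : Restriction d} {i : Fin d} (hi : ρ i = none)
    (x : Cube d) : i ∉ diffSet x (ρ.overwrite x) := by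
  simp [mem_diffSet, Restriction.overwrite, hi]

/-- Soundness needs no correctness of the operations: an output is checked by queries, and each new
deviation from `x` uses up one unit of `k`. -/
theorem mem_findMinimal (I : IDTOps d) (x : Cube d) (n : ℕ) (ρ : Restriction d) (k : ℕ)
    (A : Finset (Fin d)) {z : Cube d} (hz : z ∈ (I.findMinimal x n ρ k A).eval f) :
    f x ≠ f z ∧ (diffSet x z).card ≤ (diffSet x (ρ.overwrite x)).card + k := by
  induction n generalizing ρ k A with
  | zero =>
    rw [IDTOps.findMinimal] at hz
    simp only [QueryAlg.eval_ask] at hz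
    split at hz
    · rename_i h
      obtain rfl := by simpa using hz
      exact ⟨h, by omega⟩
    · simp only [QueryAlg.eval_bind] at hz
      split at hz <;> simp at hz
  | succ n ih =>
    rw [IDTOps.findMinimal] at hz
    simp only [QueryAlg.eval_ask] at hz
    split at hz
    · rename_i h
      obtain rfl := by simpa using hz
      exact ⟨h, by omega⟩
    · simp only [QueryAlg.eval_bind] at hz
      split at hz
      · simp at hz
      · rename_i hk
        simp only [QueryAlg.eval_bind, QueryAlg.eval_ret, Finset.mem_union] at hz
        rcases hz with hz | hz
        · obtain ⟨h1, h2⟩ := ih _ _ _ hz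
          rw [Restriction.diffSet_overwrite_set_self] at h2
          exact ⟨h1, h2.trans (by gcongr; exact Finset.erase_subset _ _)⟩
        · obtain ⟨h1, h2⟩ := ih _ _ _ hz
          rw [Restriction.diffSet_overwrite_set_not] at h2
          have := Finset.card_insert_le ((I.query ρ A).eval f).1 (diffSet x (ρ.overwrite x))
          have hk0 : k ≠ 0 := fun h => hk (Or.inr h)
          exact ⟨h1, by omega⟩

/-- At the root this shows that capping the recursion at `d` loses nothing. -/
theorem IDTOps.Navigates.depth_le {I : IDTOps d} {q : ℝ} {t : DTree d} {ρ : Restriction d}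
    {A : Finset (Fin d)} (h : I.Navigates f q t ρ A) : t.depth ≤ ρ.free.card := by
  induction t generalizing ρ A with
  | leaf b => exact Nat.zero_le _
  | node i t₀ t₁ ih₀ ih₁ =>
    obtain ⟨-, -, hi, -, A', -, h₀, h₁⟩ := h
    have h₀ := ih₀ h₀
    have h₁ := ih₁ h₁
    have hi := Restriction.mem_free.2 hi
    have := Finset.card_pos.2 ⟨i, hi⟩
    rw [Restriction.free_set, Finset.card_erase_of_mem hi] at h₀ h₁
    simp only [DTree.depth]
    omega

theorem IDTOps.Navigates.mono {I : IDTOps d} {q q' : ℝ} {t : DTree d} {ρ : Restriction d}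
    {A : Finset (Fin d)} (h : I.Navigates f q t ρ A) (hq : q ≤ q') : I.Navigates f q' t ρ A := by
  induction t generalizing ρ A with
  | leaf b => exact ⟨h.1, h.2.trans hq⟩
  | node i t₀ t₁ ih₀ ih₁ =>
    obtain ⟨h1, h2, h3, h4, A', h5, h₀, h₁⟩ := h
    exact ⟨h1, h2.trans hq, h3, h4.trans hq, A', h5, ih₀ h₀, ih₁ h₁⟩

/-- An optimal counterfactual that agrees with the node at which `FindMinimal` is started is found
there if the distance bound allows this. -/
theorem mem_findMinimal_of_optimal {I : IDTOps d} {q : ℝ} {x y : Cube d} (hxy : f x ≠ f y)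
    (hopt : (diffSet x y).card ≤ cfComplexity f x) (t : DTree d) (n : ℕ) (ρ : Restriction d)
    (k : ℕ) (A : Finset (Fin d)) (hnav : I.Navigates f q t ρ A)
    (heval : ∀ z, ρ.Agrees z → t.eval z = f z) (hn : t.depth ≤ n) (hy : ρ.Agrees y)
    (hk : (diffSet x y).card ≤ (diffSet x (ρ.overwrite x)).card + k) :
    y ∈ (I.findMinimal x n ρ k A).eval f := by
  have hsub : diffSet x (ρ.overwrite x) ⊆ diffSet x y := by
    intro i hi
    cases hρ : ρ i with
    | none => exact absurd hi (Restriction.notMem_diffSet_overwrite hρ x)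
    | some b => simpa [mem_diffSet, Restriction.overwrite, hρ, hy i b hρ] using hi
  have heq : (diffSet x y).card ≤ (diffSet x (ρ.overwrite x)).card → y = ρ.overwrite x := by
    intro hle
    have hD := Finset.eq_of_subset_of_card_le hsub hle
    funext i
    have : x i ≠ ρ.overwrite x i ↔ x i ≠ y i := by
      simpa [diffSet] using Finset.ext_iff.1 hD i
    revert this
    cases x i <;> cases y i <;> cases ρ.overwrite x i <;> simp
  rw [IDTOps.findMinimal.eq_def]
  simp only [QueryAlg.eval_ask]
  split
  -- The recursion stops at a counterfactual whose deviations from `x` are among those of `y`;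
  -- optimality of `y` makes the two equal.
  · rename_i h
    simpa using heq (hopt.trans (cfComplexity_le h))
  rename_i hfx
  have hk0 : k ≠ 0 := by
    rintro rfl
    exact hfx (heq hk ▸ hxy)
  simp only [QueryAlg.eval_bind]
  cases t with
  | leaf b =>
    have h1 := heval y hy
    have h2 := heval _ (ρ.agrees_overwrite x)
    simp only [DTree.eval] at h1 h2
    -- At a leaf, `y` and the overwritten instance get the same value, which is `f x` by the failed
    -- test.
    exact absurd (h2.symm.trans h1) (fun h => hxy ((not_not.1 hfx).trans h))
  | node i t₀ t₁ =>
    obtain ⟨hleaf, -, hi, -, A', hq, h₀, h₁⟩ := hnav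
    obtain ⟨m, rfl⟩ : ∃ m, n = m + 1 :=
      Nat.exists_eq_succ_of_ne_zero (by simp only [DTree.depth] at hn; omega)
    simp only [hleaf, hk0, Bool.false_eq_true, or_self, if_false, QueryAlg.eval_bind, hq,
      QueryAlg.eval_ret, Finset.mem_union]
    have hchild : ∃ t', I.Navigates f q t' (ρ.set i (y i)) A' ∧
        (∀ z, (ρ.set i (y i)).Agrees z → t'.eval z = f z) ∧ t'.depth ≤ m ∧
        sizeOf t' < 1 + sizeOf i + sizeOf t₀ + sizeOf t₁ := by
      simp only [DTree.depth] at hn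
      cases hyi : y i with
      | false =>
        refine ⟨t₀, h₀, fun z hz => ?_, by omega, by omega⟩
        have hz := hz.of_set hi
        simpa [DTree.eval, hz.2] using heval z hz.1
      | true =>
        refine ⟨t₁, h₁, fun z hz => ?_, by omega, by omega⟩
        have hz := hz.of_set hi
        simpa [DTree.eval, hz.2] using heval z hz.1
    obtain ⟨t', hnav', heval', hn', hsize⟩ := hchild
    have ih := fun k' => mem_findMinimal_of_optimal hxy hopt t' m (ρ.set i (y i)) k' A'
      hnav' heval' hn' hy.set
    have hni := Restriction.notMem_diffSet_overwrite hi x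
    by_cases hyi : y i = x i
    · left
      rw [hyi] at ih
      refine ih k ?_
      rw [Restriction.diffSet_overwrite_set_self, Finset.erase_eq_of_notMem hni]
      exact hk
    · right
      have hyi : y i = !x i := Bool.eq_not_of_ne hyi
      rw [hyi] at ih
      refine ih (k - 1) ?_
      rw [Restriction.diffSet_overwrite_set_not, Finset.card_insert_of_notMem hni]
      omega
termination_by sizeOf t

/-- Each call itself makes at most `2 + 2 * q` queries. The number of calls satisfies `N(D, k) ≤ 1 +
N(D - 1, k) + N(D - 1, k - 1)` with `N(D, 0) = 1`, and `2 (D + 1) ^ k - 1` dominates its solution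
since `D ^ (k + 1) + D ^ k ≤ (D + 1) ^ (k + 1)`. -/
theorem cost_findMinimal_le {I : IDTOps d} {q : ℝ} (hq0 : 0 ≤ q) (x : Cube d) (t : DTree d)
    (n : ℕ) (ρ : Restriction d) (k : ℕ) (A : Finset (Fin d)) (hnav : I.Navigates f q t ρ A) :
    ((I.findMinimal x n ρ k A).cost f : ℝ) ≤
      (2 + 2 * q) * (2 * ((t.depth : ℝ) + 1) ^ k - 1) := by
  have hone : (1 : ℝ) ≤ 2 * ((t.depth : ℝ) + 1) ^ k - 1 := by
    have : (1 : ℝ) ≤ ((t.depth : ℝ) + 1) ^ k := one_le_pow₀ (by simp)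
    linarith
  have hbase : 2 + 2 * q ≤ (2 + 2 * q) * (2 * ((t.depth : ℝ) + 1) ^ k - 1) :=
    le_mul_of_one_le_right (by linarith) hone
  have hlc : ((I.isLeaf ρ A).cost f : ℝ) ≤ q := by
    cases t with
    | leaf b => exact hnav.2
    | node i t₀ t₁ => exact hnav.2.1
  rw [IDTOps.findMinimal.eq_def]
  simp only [QueryAlg.cost_ask]
  split
  · simp only [QueryAlg.cost_ret]
    push_cast
    linarith
  simp only [QueryAlg.cost_bind]
  split
  · simp only [QueryAlg.cost_ret]
    push_cast
    linarith
  rename_i hcont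
  cases t with
  | leaf b => exact absurd (Or.inl hnav.1) hcont
  | node i t₀ t₁ =>
    obtain ⟨hleaf, -, hi, hqc, A', hq, h₀, h₁⟩ := hnav
    simp only [QueryAlg.cost_bind, hq]
    cases n with
    | zero =>
      simp only [QueryAlg.cost_ret]
      push_cast
      linarith
    | succ m =>
      obtain ⟨k, rfl⟩ : ∃ k', k = k' + 1 :=
        Nat.exists_eq_succ_of_ne_zero fun h => hcont (Or.inr h)
      simp only [QueryAlg.cost_bind, QueryAlg.cost_ret, Nat.add_sub_cancel]
      set D : ℝ := ((DTree.node i t₀ t₁).depth : ℝ) with hD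
      have hD0 : (t₀.depth : ℝ) + 1 ≤ D := by
        rw [hD]; simp only [DTree.depth]; exact_mod_cast Nat.succ_le_succ (le_max_left _ _)
      have hD1 : (t₁.depth : ℝ) + 1 ≤ D := by
        rw [hD]; simp only [DTree.depth]; exact_mod_cast Nat.succ_le_succ (le_max_right _ _)
      have hchild : ∀ (b : Bool) (k' : ℕ),
          ((I.findMinimal x m (ρ.set i b) k' A').cost f : ℝ) ≤ (2 + 2 * q) * (2 * D ^ k' - 1) := by
        intro b k'
        cases b with
        | false =>
          refine (cost_findMinimal_le hq0 x t₀ m _ k' A' h₀).trans ?_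
          gcongr
        | true =>
          refine (cost_findMinimal_le hq0 x t₁ m _ k' A' h₁).trans ?_
          gcongr
      have e1 := hchild (x i) (k + 1)
      have e2 := hchild (!x i) k
      have hD00 : 0 ≤ D := le_trans (by positivity) hD0
      have hpow : D ^ (k + 1) + D ^ k ≤ (D + 1) ^ (k + 1) := by
        have : D ^ k ≤ (D + 1) ^ k := by gcongr; linarith
        rw [pow_succ, pow_succ]
        nlinarith
      have hfin : (2 + 2 * q) * (1 + (2 * D ^ (k + 1) - 1) + (2 * D ^ k - 1)) ≤
          (2 + 2 * q) * (2 * (D + 1) ^ (k + 1) - 1) := by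
        gcongr
        linarith
      push_cast
      linarith
termination_by sizeOf t

/-- By soundness, the `j` bounds below `Δ_f` return nothing, and at `Δ_f` only optimal
counterfactuals can appear; completeness supplies all of them. -/
theorem findOptimalLoop_spec {I : IDTOps d} {q : ℝ} (hne : ∃ y z, f y ≠ f z) {t : DTree d}
    (hnav : I.Navigates f q t (emptyRestriction d) ∅) (heval : ∀ z, t.eval z = f z) {x : Cube d}
    {B : ℝ} (hB : ∀ k ≤ cfComplexity f x,
      ((I.findMinimal x d (emptyRestriction d) k ∅).cost f : ℝ) ≤ B)
    (j n k : ℕ) (hj : k + j = cfComplexity f x) (hn : j < n) :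
    (I.findOptimalLoop x n k).eval f = optimalCounterfactuals f x ∧
      ((I.findOptimalLoop x n k).cost f : ℝ) ≤ (j + 1) * B := by
  obtain ⟨n, rfl⟩ : ∃ n', n = n' + 1 := Nat.exists_eq_succ_of_ne_zero (by omega)
  have hdiff : diffSet x ((emptyRestriction d).overwrite x) = ∅ := by
    simp [diffSet, Restriction.overwrite, emptyRestriction]
  have hmem : ∀ z ∈ (I.findMinimal x d (emptyRestriction d) k ∅).eval f,
      f x ≠ f z ∧ (diffSet x z).card ≤ k := by
    intro z hz
    simpa [hdiff] using mem_findMinimal I x d _ k ∅ hz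
  have hBk := hB k (by omega)
  simp only [IDTOps.findOptimalLoop, QueryAlg.eval_bind, QueryAlg.cost_bind]
  induction j generalizing n k with
  | zero =>
    obtain rfl : k = cfComplexity f x := by omega
    have hset : (I.findMinimal x d (emptyRestriction d) (cfComplexity f x) ∅).eval f =
        optimalCounterfactuals f x := by
      ext z
      simp only [optimalCounterfactuals, Finset.mem_filter, Finset.mem_univ, true_and]
      constructor
      · intro hz
        obtain ⟨h1, h2⟩ := hmem z hz
        exact ⟨h1, le_antisymm h2 (cfComplexity_le h1)⟩
      · rintro ⟨h1, h2⟩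
        refine mem_findMinimal_of_optimal h1 h2.le t d _ _ ∅ hnav (fun z _ => heval z) ?_ ?_ ?_
        · refine hnav.depth_le.trans ((Finset.card_le_univ _).trans (by simp))
        · intro i b h
          simp [emptyRestriction] at h
        · simp [hdiff, h2]
    have hnonempty : optimalCounterfactuals f x ≠ ∅ := by
      obtain ⟨y, hy⟩ := exists_optimal hne x
      exact Finset.ne_empty_of_mem (a := y) (by simpa [optimalCounterfactuals] using hy)
    rw [hset, if_neg hnonempty]
    refine ⟨rfl, ?_⟩
    simpa using hBk
  | succ j ih =>
    have hempty : (I.findMinimal x d (emptyRestriction d) k ∅).eval f = ∅ := by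
      rw [Finset.eq_empty_iff_forall_notMem]
      intro z hz
      obtain ⟨h1, h2⟩ := hmem z hz
      have := cfComplexity_le h1
      omega
    rw [hempty, if_pos rfl]
    obtain ⟨n, rfl⟩ : ∃ n', n = n' + 1 := Nat.exists_eq_succ_of_ne_zero (by omega)
    have := ih (k + 1) (by omega) n (by omega) (fun z hz => by
      simpa [hdiff] using mem_findMinimal I x d _ (k + 1) ∅ hz) (hB _ (by omega))
    simp only [IDTOps.findOptimalLoop, QueryAlg.eval_bind, QueryAlg.cost_bind]
    refine ⟨this.1, ?_⟩
    have h2 := this.2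
    push_cast at h2 ⊢
    linarith

end FindMinimal

/-! ### Numerical estimates and the main theorem -/

theorem coinProb_eq_one {m : ℕ} {E : (Fin m → Bool) → Prop} (h : ∀ r, E r) : coinProb E = 1 := by
  have : Nat.card {r : Fin m → Bool // E r} = 2 ^ m := by
    rw [Nat.card_congr (Equiv.subtypeUnivEquiv h)]
    simp
  rw [coinProb, this]
  push_cast
  exact div_self (by positivity)

/-- With `clog 2 d = c + 1` one has `c * log 2 ≤ log d` and `log 2 ≤ log d`, so `c + 2 ≤ (3 / log 2)
* log d`, and `3 / log 2 < 5`. -/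
theorem clog_two_add_one_le {d : ℕ} (hd : 2 ≤ d) :
    ((Nat.clog 2 d : ℝ) + 1) ≤ 5 * Real.log d := by
  have hlog2 : 0.6931 < Real.log 2 := by have := Real.log_two_gt_d9; linarith
  have hlogd : Real.log 2 ≤ Real.log d :=
    Real.log_le_log (by norm_num) (by exact_mod_cast hd)
  have h1 : 2 ^ (Nat.clog 2 d - 1) < d := Nat.pow_pred_clog_lt_self (by norm_num) (by omega)
  have hpos : 0 < Nat.clog 2 d := Nat.clog_pos (by norm_num) hd
  obtain ⟨c, hc⟩ : ∃ c, Nat.clog 2 d = c + 1 := ⟨Nat.clog 2 d - 1, by omega⟩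
  rw [hc, Nat.add_sub_cancel] at h1
  have h2 : (c : ℝ) * Real.log 2 ≤ Real.log d := by
    rw [← Real.log_pow]
    exact Real.log_le_log (by positivity) (by exact_mod_cast h1.le)
  rw [hc]
  push_cast
  have hc0 : (0 : ℝ) ≤ c := Nat.cast_nonneg c
  nlinarith

/-- For `s ≥ 2` already `s * s + 1 ≤ s ^ 3`. The factor 2 is for `s = 1`, where `k ≤ s` keeps `2 ^
k` bounded. -/
theorem sensitivity_sq_add_one_pow_le {s k : ℕ} (hs : 1 ≤ s) (hk : k ≤ s) :
    (s * s + 1) ^ k ≤ 2 * s ^ (3 * k) := by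
  rcases hs.eq_or_lt with rfl | hs
  · interval_cases k <;> simp
  · rw [pow_mul]
    have : (s * s + 1) ^ k ≤ (s ^ 3) ^ k := by
      refine Nat.pow_le_pow_left ?_ k
      have : 2 * (s * s) ≤ s * (s * s) := Nat.mul_le_mul_right _ hs
      have h4 : 2 * 2 ≤ s * s := Nat.mul_le_mul hs hs
      rw [show s ^ 3 = s * (s * s) by ring]
      omega
    omega

/-- For every exponent `a` (failure probability `d ^ (-a)`) there is a constant `C` such that for
every `d ≥ 2` there are randomized IDT operations (depending on `m` coin flips `r`, and on the model
through queries only) which, for every nonconstant monotone model `f`, with high probability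
* form an implicit decision tree for `f` of depth `S(f)^{O(1)}` with `S(f)^{O(1)} log d` queries per
  operation, and
* make `FindOptimal` return the set of all optimal counterfactuals for any given instance `x` with
  `S(f)^{O(Δ_f(x))} log d` queries to `f` in total. -/
theorem theorem3p4 (a : ℕ) :
    ∃ C : ℕ, ∀ d : ℕ, 2 ≤ d →
      ∃ (m : ℕ) (I : (Fin m → Bool) → IDTOps d),
        ∀ f : Cube d → Bool, Monotone f → (∃ y z, f y ≠ f z) →
          1 - 1 / (d : ℝ) ^ a ≤ coinProb (fun r =>
            (I r).IsIDT f (C * (sensitivity f : ℝ) ^ C * Real.log d)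
              (C * (sensitivity f : ℝ) ^ C)) ∧
          ∀ x : Cube d,
            1 - 1 / (d : ℝ) ^ a ≤ coinProb (fun r =>
              ((I r).findOptimal x).eval f = optimalCounterfactuals f x ∧
              (((I r).findOptimal x).cost f : ℝ) ≤
                C * (sensitivity f : ℝ) ^ (C * cfComplexity f x) * Real.log d) := by
  -- The constant is `23 * 4`: 23 from the cost of one call, 4 from the bound on the number of
  -- calls. Feature 0 is only a default value.
  refine ⟨92, fun d hd => ⟨0, fun _ => mintermOps ⟨0, by omega⟩, fun f hf hne => ?_⟩⟩
  have hprob : 1 - 1 / (d : ℝ) ^ a ≤ 1 := by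
    have : 0 ≤ 1 / (d : ℝ) ^ a := by positivity
    linarith
  have hS : 1 ≤ sensitivity f := by
    obtain ⟨y, -⟩ := id hne
    exact (cfComplexity_pos hne y).trans (cfComplexity_le_sensitivity hf hne y)
  obtain ⟨t, heval, hdepth, hnav⟩ := exists_navigates_root hf (⟨0, by omega⟩ : Fin d) hS
  set s := sensitivity f with hs
  have hs1 : (1 : ℝ) ≤ s := by exact_mod_cast hS
  have hlogd : 0.69 ≤ Real.log d := by
    have h1 := Real.log_two_gt_d9
    have h2 : Real.log 2 ≤ Real.log d := Real.log_le_log (by norm_num) (by exact_mod_cast hd)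
    linarith
  have hq : (mintermCost f : ℝ) ≤ 10 * s * Real.log d := by
    have h1 := clog_two_add_one_le hd
    have h2 : (s : ℝ) + 1 ≤ 2 * s := by linarith
    calc (mintermCost f : ℝ) = ((s : ℝ) + 1) * ((Nat.clog 2 d : ℝ) + 1) := by
          simp [mintermCost, hs]
      _ ≤ (2 * s) * (5 * Real.log d) := by gcongr
      _ = 10 * s * Real.log d := by ring
  refine ⟨?_, fun x => ?_⟩
  · rw [coinProb_eq_one]
    · exact hprob
    intro r
    refine ⟨t, heval, ?_, hnav.mono (hq.trans ?_)⟩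
    · calc (t.depth : ℝ) ≤ (s : ℝ) * s := by exact_mod_cast hdepth
        _ = 1 * (s : ℝ) ^ 2 := by ring
        _ ≤ (92 : ℕ) * (s : ℝ) ^ 92 := by
          gcongr
          · norm_num
          · norm_num
    · gcongr
      · norm_num
      · exact le_self_pow₀ hs1 (by norm_num)
  · have hk1 := cfComplexity_pos hne x
    have hks := cfComplexity_le_sensitivity hf hne x
    obtain ⟨j, hj⟩ : ∃ j, cfComplexity f x = j + 1 := ⟨cfComplexity f x - 1, by omega⟩
    have hq0 : (0 : ℝ) ≤ mintermCost f := Nat.cast_nonneg _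
    have hloop := findOptimalLoop_spec hne hnav heval (x := x)
      (B := (2 + 2 * mintermCost f) * (2 * ((s : ℝ) * s + 1) ^ cfComplexity f x - 1))
      (fun k hk => by
        refine (cost_findMinimal_le hq0 x t d _ k ∅ hnav).trans ?_
        have : (t.depth : ℝ) ≤ s * s := by exact_mod_cast hdepth
        have h1 : ((t.depth : ℝ) + 1) ^ k ≤ ((s : ℝ) * s + 1) ^ k := by gcongr
        have h2 : ((s : ℝ) * s + 1) ^ k ≤ ((s : ℝ) * s + 1) ^ cfComplexity f x :=
          pow_le_pow_right₀ (by nlinarith) hk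
        gcongr
        exact h1.trans h2) j d 1 (by omega) (by have := sensitivity_le f; omega)
    rw [coinProb_eq_one]
    · exact hprob
    intro r
    refine ⟨hloop.1, hloop.2.trans ?_⟩
    have hjs : (j : ℝ) + 1 ≤ s := by
      rw [hj] at hks
      exact_mod_cast hks
    have hpow : ((s : ℝ) * s + 1) ^ cfComplexity f x ≤ 2 * (s : ℝ) ^ (3 * cfComplexity f x) := by
      exact_mod_cast sensitivity_sq_add_one_pow_le hS hks
    -- Here `2 * 10 = 20` comes from the operations, and `2 ≤ 3 * 0.69` absorbs the two direct
    -- queries.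
    have hnode : 2 + 2 * (mintermCost f : ℝ) ≤ 23 * s * Real.log d := by
      have : 0.69 ≤ s * Real.log d := by nlinarith
      linarith
    calc ((j : ℝ) + 1) *
          ((2 + 2 * mintermCost f) * (2 * ((s : ℝ) * s + 1) ^ cfComplexity f x - 1))
        ≤ s * ((23 * s * Real.log d) * (2 * (2 * (s : ℝ) ^ (3 * cfComplexity f x)))) := by
          have h1 : (1 : ℝ) ≤ ((s : ℝ) * s + 1) ^ cfComplexity f x :=
            one_le_pow₀ (by nlinarith)
          have h2 : (0 : ℝ) ≤ 2 * ((s : ℝ) * s + 1) ^ cfComplexity f x - 1 := by linarith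
          gcongr
          linarith
      _ = 92 * (s : ℝ) ^ (3 * cfComplexity f x + 2) * Real.log d := by ring
      _ ≤ (92 : ℕ) * (s : ℝ) ^ (92 * cfComplexity f x) * Real.log d := by
          -- The additive 2 is absorbed because `Δ_f ≥ 1`.
          have : (s : ℝ) ^ (3 * cfComplexity f x + 2) ≤ (s : ℝ) ^ (92 * cfComplexity f x) :=
            pow_le_pow_right₀ hs1 (by omega)
          push_cast
          gcongr
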